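/- Let $X$ and $Y$ be Banach spaces over the same scalar field $\mathbb{K}\in\{\mathbb{R},\mathbb{C}\}$, and write $\mathbb{N}=\{1,2,3,\ldots\}$. For $k\in\mathbb{Z}$, let $\Phi_k(X)$ denote the set of Fredholm operators $T$ on $X$ (that is, bounded linear maps $T\colon X\to X$ for which $\ker T$ and $X/\operatorname{ran}T$ are finite-dimensional) with index $\dim\ker T-\dim X/\operatorname{ran}T=k$. Bounded linear operators $U\colon X\to X$ and $V\colon Y\to Y$ are *Schur coupled* if there are isomorphisms (bounded linear bijections) $A\colon X\to X$ and $D\colon Y\to Y$ and bounded linear operators $B\colon Y\to X$ and $C\colon X\to Y$ such that $U=A-BD^{-1}C$ and $V=D-CA^{-1}B$. Set $$\operatorname{SC}_k(X,Y)=\{(U,V)\in\Phi_k(X)\times\Phi_k(Y): U\text{ and }V\text{ are Schur coupled}\},$$ $$\mathbb{I}_\Phi(X)=\{k\in\mathbb{Z}:\Phi_k(X)\neq\emptyset\},\qquad \mathbb{I}_{\mathrm{SC}}(X,Y)=\{k\in\mathbb{Z}:\operatorname{SC}_k(X,Y)\neq\emptyset\}.$$ Let $\operatorname{eae}(X,Y)$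 be the minimum of $\mathbb{I}_\Phi(X)\cap\mathbb{I}_\Phi(Y)\cap\mathbb{N}$ if this set is non-empty, and $0$ otherwise; let $\operatorname{sc}(X,Y)$ be the minimum of $\mathbb{I}_{\mathrm{SC}}(X,Y)\cap\mathbb{N}$ if this set is non-empty, and $0$ otherwise. Then: (i) $0\in\mathbb{I}_{\mathrm{SC}}(X,Y)$. (ii) $\operatorname{sc}(X,Y)\in\mathbb{I}_{\mathrm{SC}}(X,Y)$. (iii) $km\in\mathbb{I}_{\mathrm{SC}}(X,Y)$ for every $k\in\mathbb{I}_{\mathrm{SC}}(X,Y)$ and every $m\in\mathbb{Z}$. (iv) If $\operatorname{sc}(X,Y)\in\{0,\operatorname{eae}(X,Y)\}$, then $\mathbb{I}_{\mathrm{SC}}(X,Y)=\operatorname{sc}(X,Y)\,\mathbb{Z}$. -/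

import Mathlib

namespace SchurCoupling

section Defs

variable {𝕜 : Type*} [RCLike 𝕜]
  {X : Type*} [NormedAddCommGroup X] [NormedSpace 𝕜 X]
  {Y : Type*} [NormedAddCommGroup Y] [NormedSpace 𝕜 Y]

/-- Between Banach spaces, Mathlib's notion of a Fredholm operator is the usual one: the kernel
and the cokernel are finite-dimensional. -/
theorem isFredholm_iff [CompleteSpace X] [CompleteSpace Y] (T : X →L[𝕜] Y) :
    T.IsFredholm ↔ FiniteDimensional 𝕜 T.ker ∧ FiniteDimensional 𝕜 (Y ⧸ T.range) := by
  constructor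
  · intro h
    exact ⟨h.finite_ker, h.finite_coker⟩
  · rintro ⟨hk, hc⟩
    obtain ⟨G, hG⟩ := T.range.exists_isCompl
    have : FiniteDimensional 𝕜 G :=
      (Submodule.quotientEquivOfIsCompl T.range G hG).finiteDimensional
    have : IsClosed (T.ker : Set X) := T.isClosed_ker
    have hcl : IsClosed (T.range : Set Y) := by
      have hr : (T.ker.liftQL T le_rfl).range = T.range :=
        Submodule.range_liftQ T.ker (T : X →ₗ[𝕜] Y) le_rfl
      have h := ContinuousLinearMap.closed_complemented_range_of_isCompl_of_ker_eq_bot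
        (T.ker.liftQL T le_rfl) G (by rw [hr]; exact hG) G.closed_of_finiteDimensional
        (Submodule.ker_liftQ_eq_bot T.ker (T : X →ₗ[𝕜] Y) le_rfl le_rfl)
      rwa [hr] at h
    have : CompleteSpace T.range := hcl.completeSpace_coe
    refine ⟨?_, hcl, hk, hc, Submodule.ClosedComplemented.of_finiteDimensional _⟩
    have hs : Function.Surjective T.rangeRestrict :=
      (T : X →ₗ[𝕜] Y).surjective_rangeRestrict
    exact (LinearMap.isStrictMap_iff_isOpenQuotientMap_rangeRestrict
      (f := (T : X →ₗ[𝕜] Y))).2 ⟨hs, T.rangeRestrict.continuous, T.rangeRestrict.isOpenMap hs⟩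

/-- The set `Φ_k(X)` of Fredholm operators of index `k` on `X`, where the index of `T` is
`dim (ker T) - dim (X / ran T)`. -/
def fredholmOfIndex (𝕜 : Type*) [RCLike 𝕜] (X : Type*) [NormedAddCommGroup X] [NormedSpace 𝕜 X]
    (k : ℤ) : Set (X →L[𝕜] X) :=
  {T | T.IsFredholm ∧ (T : X →ₗ[𝕜] X).index = k}

/-- Schur coupling: `U = A - B D⁻¹ C` and `V = D - C A⁻¹ B` for some isomorphisms `A`, `D` and
some operators `B`, `C`. -/
def SchurCoupled (U : X →L[𝕜] X) (V : Y →L[𝕜] Y) : Prop :=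
  ∃ (A : X ≃L[𝕜] X) (D : Y ≃L[𝕜] Y) (B : Y →L[𝕜] X) (C : X →L[𝕜] Y),
    U = (A : X →L[𝕜] X) - B ∘L (D.symm : Y →L[𝕜] Y) ∘L C ∧
    V = (D : Y →L[𝕜] Y) - C ∘L (A.symm : X →L[𝕜] X) ∘L B

/-- The set `SC_k(X, Y)` of Schur-coupled pairs of Fredholm operators of index `k`. -/
def SC (𝕜 : Type*) [RCLike 𝕜] (X : Type*) [NormedAddCommGroup X] [NormedSpace 𝕜 X]
    (Y : Type*) [NormedAddCommGroup Y] [NormedSpace 𝕜 Y] (k : ℤ) :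
    Set ((X →L[𝕜] X) × (Y →L[𝕜] Y)) :=
  {p | p.1 ∈ fredholmOfIndex 𝕜 X k ∧ p.2 ∈ fredholmOfIndex 𝕜 Y k ∧ SchurCoupled p.1 p.2}

/-- The set `I_Φ(X)` of all indices of Fredholm operators on `X`. -/
def IPhi (𝕜 : Type*) [RCLike 𝕜] (X : Type*) [NormedAddCommGroup X] [NormedSpace 𝕜 X] : Set ℤ :=
  {k | (fredholmOfIndex 𝕜 X k).Nonempty}

/-- The set `I_SC(X, Y)` of all `k` for which `SC_k(X, Y)` is nonempty. -/
def ISC (𝕜 : Type*) [RCLike 𝕜] (X : Type*) [NormedAddCommGroup X] [NormedSpace 𝕜 X]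
    (Y : Type*) [NormedAddCommGroup Y] [NormedSpace 𝕜 Y] : Set ℤ :=
  {k | (SC 𝕜 X Y k).Nonempty}

/-- The least positive element of a set of integers, and `0` if there is none. -/
noncomputable def minPos (S : Set ℤ) : ℕ :=
  open Classical in
  if h : ∃ n : ℕ, 0 < n ∧ (n : ℤ) ∈ S then Nat.find h else 0

/-- The index `eae(X, Y)`. -/
noncomputable def eae (𝕜 : Type*) [RCLike 𝕜]
    (X : Type*) [NormedAddCommGroup X] [NormedSpace 𝕜 X]
    (Y : Type*) [NormedAddCommGroup Y] [NormedSpace 𝕜 Y] : ℕ :=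
  minPos (IPhi 𝕜 X ∩ IPhi 𝕜 Y)

/-- The index `sc(X, Y)`. -/
noncomputable def sc (𝕜 : Type*) [RCLike 𝕜]
    (X : Type*) [NormedAddCommGroup X] [NormedSpace 𝕜 X]
    (Y : Type*) [NormedAddCommGroup Y] [NormedSpace 𝕜 Y] : ℕ :=
  minPos (ISC 𝕜 X Y)

end Defs

end SchurCoupling

namespace LinearMap

variable {K V W : Type*} [Field K] [AddCommGroup V] [Module K V] [AddCommGroup W] [Module K W]

/-! Absorbing the isomorphisms turns a Schur-coupled pair into `1 - P Q`, `1 - Q P` (`mem_ISC_iff`).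
Such pairs are closed under simultaneous powers and, modulo finite rank, under simultaneous
inversion, so the coupled indices are closed under integer multiples. Sums of two coupled indices
are not controlled, as `P` may differ. The common Fredholm indices do form a subgroup of ℤ,
generated by `eae` if that is nonzero; it contains all coupled indices, so `sc = eae` forces
equality. -/

/-- `b` and `a` restrict to mutually inverse maps of the kernels, since `a b x = x` there. -/
theorem finrank_ker_id_sub_comp_comm (a : W →ₗ[K] V) (b : V →ₗ[K] W) :
    Module.finrank K (id - a ∘ₗ b).ker = Module.finrank K (id - b ∘ₗ a).ker := by
  have hb : ∀ x ∈ (id - a ∘ₗ b).ker, b x ∈ (id - b ∘ₗ a).ker := by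
    intro x hx
    simp only [mem_ker, sub_apply, id_apply, comp_apply, sub_eq_zero] at hx ⊢
    rw [← hx]
  have ha : ∀ y ∈ (id - b ∘ₗ a).ker, a y ∈ (id - a ∘ₗ b).ker := by
    intro y hy
    simp only [mem_ker, sub_apply, id_apply, comp_apply, sub_eq_zero] at hy ⊢
    rw [← hy]
  refine LinearEquiv.finrank_eq (LinearEquiv.ofLinearMap (b.restrict hb) (a.restrict ha) ?_ ?_)
  · ext ⟨y, hy⟩
    simp only [mem_ker, sub_apply, id_apply, comp_apply, sub_eq_zero] at hy
    simpa using hy.symm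
  · ext ⟨x, hx⟩
    simp only [mem_ker, sub_apply, id_apply, comp_apply, sub_eq_zero] at hx
    simpa using hx.symm

theorem finrank_coker_id_sub_comp_comm (a : W →ₗ[K] V) (b : V →ₗ[K] W) :
    Module.finrank K (V ⧸ (id - a ∘ₗ b).range) = Module.finrank K (W ⧸ (id - b ∘ₗ a).range) := by
  have hb : (id - a ∘ₗ b).range ≤ (id - b ∘ₗ a).range.comap b := by
    rintro _ ⟨x, rfl⟩
    exact ⟨b x, by simp⟩
  have ha : (id - b ∘ₗ a).range ≤ (id - a ∘ₗ b).range.comap a := by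
    rintro _ ⟨y, rfl⟩
    exact ⟨a y, by simp⟩
  refine LinearEquiv.finrank_eq (LinearEquiv.ofLinearMap (Submodule.mapQ _ _ b hb)
    (Submodule.mapQ _ _ a ha) ?_ ?_)
  · ext y
    refine (Submodule.Quotient.eq _).2 ⟨-y, ?_⟩
    simp
    abel
  · ext x
    refine (Submodule.Quotient.eq _).2 ⟨-x, ?_⟩
    simp
    abel

theorem index_id_sub_comp_comm (a : W →ₗ[K] V) (b : V →ₗ[K] W) :
    (id - a ∘ₗ b).index = (id - b ∘ₗ a).index := by
  rw [index_eq_finrank_sub, index_eq_finrank_sub, finrank_ker_id_sub_comp_comm,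
    finrank_coker_id_sub_comp_comm]

open scoped FiniteRangeSetoid in
/-- A finite rank perturbation of the identity has index zero. -/
theorem index_eq_zero_of_equiv_id {f : V →ₗ[K] V} (h : f ≈ id) : f.index = 0 := by
  have hr : (id - f).HasFiniteRange :=
    FiniteRangeSetoid.equiv_iff_hasFiniteRange.1 (Setoid.symm h)
  have : FiniteDimensional K (id - f).range := Module.Finite.of_fg hr
  -- Factoring through the finite-dimensional range and swapping the factors moves the index to that
  -- range, where it vanishes.
  have hf : f = id - (id - f).range.subtype ∘ₗ (id - f).rangeRestrict := by
    ext x; simp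
  rw [hf, index_id_sub_comp_comm, index_eq_of_finiteDimensional, sub_self]

end LinearMap

namespace SchurCoupling

open ContinuousLinearMap
open scoped LinearMap.FiniteRangeSetoid

section

variable {𝕜 : Type*} [RCLike 𝕜]
  {X : Type*} [NormedAddCommGroup X] [NormedSpace 𝕜 X]
  {Y : Type*} [NormedAddCommGroup Y] [NormedSpace 𝕜 Y]

theorem comp_mem_fredholmOfIndex {S T : X →L[𝕜] X} {k l : ℤ}
    (hS : S ∈ fredholmOfIndex 𝕜 X k) (hT : T ∈ fredholmOfIndex 𝕜 X l) :
    S ∘L T ∈ fredholmOfIndex 𝕜 X (k + l) := by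
  obtain ⟨S', hS'⟩ := hS.1.exists_isQuasiInverse
  obtain ⟨T', hT'⟩ := hT.1.exists_isQuasiInverse
  refine ⟨IsFredholm.of_isQuasiInverse (v := T' ∘L S') (hT'.comp hS'), ?_⟩
  have := hS.1.finite_ker
  have := hT.1.finite_ker
  have : FiniteDimensional 𝕜 (X ⧸ S.range) := hS.1.finite_coker
  have : FiniteDimensional 𝕜 (X ⧸ T.range) := hT.1.finite_coker
  rw [← hS.2, ← hT.2]
  exact LinearMap.index_comp (f := (T : X →ₗ[𝕜] X)) (S : X →ₗ[𝕜] X)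

theorem equiv_mem_fredholmOfIndex (e : X ≃L[𝕜] X) :
    (e : X →L[𝕜] X) ∈ fredholmOfIndex 𝕜 X 0 :=
  ⟨IsFredholm.of_isQuasiInverse (v := (e.symm : X →L[𝕜] X)) e.toLinearEquiv.isQuasiInverse,
    LinearEquiv.index_eq_zero (e := e.toLinearEquiv)⟩

theorem one_mem_fredholmOfIndex : (1 : X →L[𝕜] X) ∈ fredholmOfIndex 𝕜 X 0 :=
  equiv_mem_fredholmOfIndex (ContinuousLinearEquiv.refl 𝕜 X)

/-- Passing to a quasi-inverse changes the sign of the index. -/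
theorem quasiInverse_mem_fredholmOfIndex {S T : X →L[𝕜] X} {k : ℤ}
    (hT : T ∈ fredholmOfIndex 𝕜 X k)
    (h : (S : X →ₗ[𝕜] X).IsQuasiInverse (T : X →ₗ[𝕜] X)) :
    S ∈ fredholmOfIndex 𝕜 X (-k) := by
  have hS : S.IsFredholm := IsFredholm.of_isQuasiInverse h.symm
  refine ⟨hS, ?_⟩
  have h1 := (comp_mem_fredholmOfIndex ⟨hS, rfl⟩ hT).2
  have h2 : ((S ∘L T : X →L[𝕜] X) : X →ₗ[𝕜] X).index = 0 :=
    LinearMap.index_eq_zero_of_equiv_id h.1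
  omega

theorem pow_mem_fredholmOfIndex {T : X →L[𝕜] X} {k : ℤ} (hT : T ∈ fredholmOfIndex 𝕜 X k)
    (n : ℕ) : T ^ n ∈ fredholmOfIndex 𝕜 X (k * n) := by
  induction n with
  | zero => simpa using one_mem_fredholmOfIndex
  | succ n ih =>
    rw [pow_succ', show k * ((n + 1 : ℕ) : ℤ) = k + k * n by push_cast; ring]
    exact comp_mem_fredholmOfIndex hT ih

variable (𝕜 X) in
/-- The indices of the Fredholm operators on a space form a group. -/
def indexSubgroup : AddSubgroup ℤ where
  carrier := IPhi 𝕜 X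
  add_mem' := fun ⟨S, hS⟩ ⟨T, hT⟩ => ⟨S ∘L T, comp_mem_fredholmOfIndex hS hT⟩
  zero_mem' := ⟨_, one_mem_fredholmOfIndex⟩
  neg_mem' := fun ⟨_, hT⟩ =>
    let ⟨S, hS⟩ := hT.1.exists_isQuasiInverse
    ⟨S, quasiInverse_mem_fredholmOfIndex hT hS⟩

/-- Up to isomorphisms, Schur-coupled pairs have the form `1 - P Q`, `1 - Q P`. -/
theorem mem_ISC_iff {k : ℤ} :
    k ∈ ISC 𝕜 X Y ↔ ∃ (P : Y →L[𝕜] X) (Q : X →L[𝕜] Y),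
      (1 - P ∘L Q : X →L[𝕜] X) ∈ fredholmOfIndex 𝕜 X k ∧
      (1 - Q ∘L P : Y →L[𝕜] Y) ∈ fredholmOfIndex 𝕜 Y k := by
  constructor
  · rintro ⟨⟨U, V⟩, hU, hV, A, D, B, C, rfl, rfl⟩
    refine ⟨(A.symm : X →L[𝕜] X) ∘L B, (D.symm : Y →L[𝕜] Y) ∘L C, ?_, ?_⟩
    · convert comp_mem_fredholmOfIndex (equiv_mem_fredholmOfIndex A.symm) hU using 1
      · rw [zero_add]
      · ext x; rw [comp_apply]; simp
    · convert comp_mem_fredholmOfIndex (equiv_mem_fredholmOfIndex D.symm) hV using 1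
      · rw [zero_add]
      · ext x; rw [comp_apply]; simp
  · rintro ⟨P, Q, hU, hV⟩
    refine ⟨⟨_, _⟩, hU, hV, ContinuousLinearEquiv.refl 𝕜 X, ContinuousLinearEquiv.refl 𝕜 Y,
      P, Q, ?_, ?_⟩ <;> · ext x; simp

theorem exists_one_sub_comp_eq_pow (P : Y →L[𝕜] X) (Q : X →L[𝕜] Y) (n : ℕ) :
    ∃ R : X →L[𝕜] Y, (1 - P ∘L R : X →L[𝕜] X) = (1 - P ∘L Q) ^ n ∧
      (1 - R ∘L P : Y →L[𝕜] Y) = (1 - Q ∘L P) ^ n := by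
  induction n with
  | zero => exact ⟨0, by simp, by simp⟩
  | succ n ih =>
    obtain ⟨R, h1, h2⟩ := ih
    -- Read off from `(1 - PQ)(1 - PR) = 1 - P(Q + R - QPR)`.
    refine ⟨Q + R - Q ∘L P ∘L R, ?_, ?_⟩
    · rw [pow_succ', ← h1]
      ext x
      simp
      abel
    · rw [pow_succ', ← h2]
      ext y
      simp
      abel

theorem mul_natCast_mem_ISC {k : ℤ} (hk : k ∈ ISC 𝕜 X Y) (n : ℕ) : k * n ∈ ISC 𝕜 X Y := by
  obtain ⟨P, Q, hX, hY⟩ := mem_ISC_iff.1 hk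
  obtain ⟨R, h1, h2⟩ := exists_one_sub_comp_eq_pow P Q n
  exact mem_ISC_iff.2 ⟨P, R, h1 ▸ pow_mem_fredholmOfIndex hX n, h2 ▸ pow_mem_fredholmOfIndex hY n⟩

/-- Finite-rank maps form an ideal, so a finite-rank defect on one space passes to the other. -/
theorem equiv_id_of_sub_eq_comp {E F : Type*} [AddCommGroup E] [Module 𝕜 E]
    [AddCommGroup F] [Module 𝕜 F] {g : E →ₗ[𝕜] E} {f : F →ₗ[𝕜] F} (hf : f ≈ LinearMap.id)
    (a : F →ₗ[𝕜] E) (b : E →ₗ[𝕜] F) (h : g - LinearMap.id = a ∘ₗ (f - LinearMap.id) ∘ₗ b) :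
    g ≈ LinearMap.id := by
  rw [LinearMap.FiniteRangeSetoid.equiv_iff_hasFiniteRange] at hf ⊢
  rw [h]
  exact (hf.comp_right b).comp_left a

theorem neg_mem_ISC {k : ℤ} (hk : k ∈ ISC 𝕜 X Y) : -k ∈ ISC 𝕜 X Y := by
  obtain ⟨P, Q, hX, hY⟩ := mem_ISC_iff.1 hk
  obtain ⟨S, hST, hTS⟩ := hX.1.exists_isQuasiInverse
  -- If `S` inverts `1 - PQ`, then `S = 1 + PQ + PQSPQ` and `(1 - QP)⁻¹ = 1 + QP + QSPQP`; both have
  -- the coupled form for this pair.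
  refine mem_ISC_iff.2 ⟨-P, (1 + Q ∘L S ∘L P) ∘L Q, quasiInverse_mem_fredholmOfIndex hX ⟨?_, ?_⟩,
    quasiInverse_mem_fredholmOfIndex hY ⟨?_, ?_⟩⟩
  · refine equiv_id_of_sub_eq_comp hST.equiv (P ∘L Q : X →L[𝕜] X) (P ∘L Q : X →L[𝕜] X) ?_
    ext x
    simp
    abel
  · refine equiv_id_of_sub_eq_comp hTS.equiv (P ∘L Q : X →L[𝕜] X) (P ∘L Q : X →L[𝕜] X) ?_
    ext x
    simp
    abel
  · refine equiv_id_of_sub_eq_comp hST.equiv (Q : X →L[𝕜] Y) (P ∘L Q ∘L P : Y →L[𝕜] X) ?_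
    ext x
    simp
    abel
  · refine equiv_id_of_sub_eq_comp hTS.equiv (Q : X →L[𝕜] Y) (P ∘L Q ∘L P : Y →L[𝕜] X) ?_
    ext x
    simp
    abel

theorem mul_mem_ISC {k : ℤ} (hk : k ∈ ISC 𝕜 X Y) (m : ℤ) : k * m ∈ ISC 𝕜 X Y := by
  obtain ⟨n, rfl | rfl⟩ := m.eq_nat_or_neg
  · exact mul_natCast_mem_ISC hk n
  · rw [mul_neg]
    exact neg_mem_ISC (mul_natCast_mem_ISC hk n)

variable (𝕜 X Y) in
theorem zero_mem_ISC : (0 : ℤ) ∈ ISC 𝕜 X Y :=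
  mem_ISC_iff.2 ⟨0, 0, by rw [zero_comp, sub_zero]; exact one_mem_fredholmOfIndex,
    by rw [zero_comp, sub_zero]; exact one_mem_fredholmOfIndex⟩

end

theorem minPos_mem {S : Set ℤ} (h0 : (0 : ℤ) ∈ S) : (minPos S : ℤ) ∈ S := by
  classical
  unfold minPos
  split_ifs with h
  · exact (Nat.find_spec h).2
  · exact h0

theorem minPos_eq_zero_iff {S : Set ℤ} : minPos S = 0 ↔ ∀ n : ℕ, (n : ℤ) ∈ S → n = 0 := by
  classical
  unfold minPos
  split_ifs with h
  · obtain ⟨n, hn, hS⟩ := id h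
    exact ⟨fun h' => absurd h' (Nat.find_spec h).1.ne', fun h' => absurd (h' n hS) hn.ne'⟩
  · push Not at h
    exact ⟨fun _ n hn => by by_contra h'; exact h n (Nat.pos_of_ne_zero h') hn, fun _ => rfl⟩

theorem minPos_le {S : Set ℤ} {n : ℕ} (hn : 0 < n) (hS : (n : ℤ) ∈ S) : minPos S ≤ n := by
  classical
  have h : ∃ n : ℕ, 0 < n ∧ (n : ℤ) ∈ S := ⟨n, hn, hS⟩
  unfold minPos
  rw [dif_pos h]
  exact Nat.find_min' h ⟨hn, hS⟩

theorem minPos_dvd (G : AddSubgroup ℤ) {k : ℤ} (hpos : minPos (G : Set ℤ) ≠ 0) (hk : k ∈ G) :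
    (minPos (G : Set ℤ) : ℤ) ∣ k := by
  set e := minPos (G : Set ℤ) with he
  have heG : (e : ℤ) ∈ G := minPos_mem G.zero_mem
  have he0 : (0 : ℤ) < e := by omega
  -- A nonzero remainder would be a smaller positive element.
  have hmod : k % e ∈ G := by
    rw [Int.emod_def, mul_comm]
    exact G.sub_mem hk (by simpa using G.zsmul_mem heG (k / e))
  have h1 := Int.emod_nonneg k he0.ne'
  have h2 := Int.emod_lt_of_pos k he0
  lift k % e to ℕ using h1 with r hr
  refine Int.dvd_of_emod_eq_zero (hr ▸ ?_)
  by_contra hne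
  have := minPos_le (S := (G : Set ℤ)) (n := r) (by omega) hmod
  omega

end SchurCoupling

theorem lemma5p1 (𝕜 : Type*) [RCLike 𝕜]
    (X : Type*) [NormedAddCommGroup X] [NormedSpace 𝕜 X] [CompleteSpace X]
    (Y : Type*) [NormedAddCommGroup Y] [NormedSpace 𝕜 Y] [CompleteSpace Y] :
    (0 : ℤ) ∈ SchurCoupling.ISC 𝕜 X Y ∧
    (SchurCoupling.sc 𝕜 X Y : ℤ) ∈ SchurCoupling.ISC 𝕜 X Y ∧
    (∀ k ∈ SchurCoupling.ISC 𝕜 X Y, ∀ m : ℤ, k * m ∈ SchurCoupling.ISC 𝕜 X Y) ∧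
    (SchurCoupling.sc 𝕜 X Y ∈ ({0, SchurCoupling.eae 𝕜 X Y} : Set ℕ) →
      SchurCoupling.ISC 𝕜 X Y = {k : ℤ | ∃ m : ℤ, k = (SchurCoupling.sc 𝕜 X Y : ℤ) * m}) := by
  have h0 := SchurCoupling.zero_mem_ISC 𝕜 X Y
  have hsc : (SchurCoupling.sc 𝕜 X Y : ℤ) ∈ SchurCoupling.ISC 𝕜 X Y :=
    SchurCoupling.minPos_mem h0
  refine ⟨h0, hsc, fun k hk m => SchurCoupling.mul_mem_ISC hk m, fun h => ?_⟩
  refine Set.Subset.antisymm (fun k hk => ?_) ?_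
  · by_cases hz : SchurCoupling.sc 𝕜 X Y = 0
    · have hmin := SchurCoupling.minPos_eq_zero_iff.1 hz
      refine ⟨0, ?_⟩
      rw [mul_zero]
      obtain ⟨n, rfl | rfl⟩ := k.eq_nat_or_neg
      · exact_mod_cast hmin n hk
      · have := hmin n (by simpa using SchurCoupling.neg_mem_ISC hk)
        simp [this]
    · have he : SchurCoupling.sc 𝕜 X Y = SchurCoupling.eae 𝕜 X Y := h.resolve_left hz
      obtain ⟨⟨U, V⟩, hU, hV, -⟩ := hk
      rw [he] at hz ⊢
      exact SchurCoupling.minPos_dvd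
        (SchurCoupling.indexSubgroup 𝕜 X ⊓ SchurCoupling.indexSubgroup 𝕜 Y) hz
        ⟨⟨U, hU⟩, ⟨V, hV⟩⟩
  · rintro _ ⟨m, rfl⟩
    exact SchurCoupling.mul_mem_ISC hsc m
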